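/- **Higher-order derivatives of Lambert series expansions.** Let $\alpha\ge 0$ be real and let $s\ge 1$ be an integer. For $q\in\mathbb C$ with $|q|<1$ put $$F_\alpha(q)=\sum_{i\ge 1}\frac{i^\alpha q^i}{1-q^i}.$$ Let $\left[{n\atop k}\right]$ and $\left\{{n\atop k}\right\}$ be the (unsigned) Stirling numbers of the first and of the second kind, and let $\binom{a}{b}=0$ for integers $a\ge 0$ and $b<0$ or $b>a$. For integers $0\le r\le s$ and $p,m,w\ge0$ and $0\le n\le r+1$ put $$C_{4,s}(r,p,m)=\sum_{k=0}^m\binom sr\left[{s-r\atop m}\right]\left\{{m\atop k}\right\}\binom{s-r-k}{p}(-1)^{s-r-k+p}\,k!\,r!$$ (a summand with $k>s-r$ is $0$, since then $\left[{s-r\atop m}\right]=0$) and $$C_{8,s}(r,p,n,w)=\sum_{m=0}^{s-r}\sum_{k=0}^m\sum_{m_1=0}^{r+1-n}\sum_{m_2=0}^n\binom sr\left[{s-r\atop m}\right]\left\{{m\atop k}\right\}\binom{s-r-k}{p}\left[{r+1-n\atop m_1}\right]\left[{n\atop m_2}\right]\binom{m_2}{w-m-m_1}(-1)^{s-k+p+n+m_1+m_2}\,k!\,(n-2-r)^{m+m_1+m_2-w}.$$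 For integers $i\ge 1$ and $|q|<1$ put $$\mathrm{Sum}_{4,s}(q,i)=\sum_{0\le r,p,m\le s}\frac{q^{(p+1)i+r}}{(1-q^i)^{s-r+1}}\left(\frac{i^{m+1}}{(1-q)^{r+1}}-\frac{(r+1)\,i^m}{(1-q)^{r+2}}\right)C_{4,s}(r,p,m),$$ $$\mathrm{Sum}_{8,s}(q,i)=\sum_{0\le r,p\le s}\ \sum_{n=0}^{r+1}\sum_{w=0}^s\frac{q^{(p+2)i+n-1}}{(1-q^i)^{s-r+1}}\left(\binom rn\frac1{(1-q)^{r+1}}-\binom{r+1}n\frac1{(1-q)^{r+2}}\right)i^w\,C_{8,s}(r,p,n,w).$$ Let $D^{(s)}$ be the $s$-th derivative with respect to $q$. Then the series $$F_\alpha(q),\qquad \sum_{i\ge1}\frac{i^{\alpha-1}q^i}{(1-q)^2},\qquad \sum_{i\ge1}\mathrm{Sum}_{4,s}(q,i)\,i^{\alpha-1},\qquad \sum_{i\ge1}\mathrm{Sum}_{8,s}(q,i)\,i^{\alpha-1}$$ converge for $|q|<1$, the last three sums and $F_\alpha(q)/(1-q)$ are holomorphic there, and for all $|q|<1$ $$q^sD^{(s)}\left[\frac{F_\alpha(q)}{1-q}\right]=q^sD^{(s)}\left[\sum_{i\ge1}\frac{i^{\alpha-1}q^i}{(1-q)^2}\right]+\sum_{i\ge1}\bigl(\mathrm{Sum}_{4,s}(q,i)+\mathrm{Sum}_{8,s}(q,i)\bigr)\,i^{\alpha-1}.$$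 Correspondingly, with $[q^x]$ denoting the coefficient of $q^x$ in the power series expansion at $q=0$, the coefficients $$L_{s,x}^{(\alpha)}=[q^x]\,q^sD^{(s)}\left[\frac{F_\alpha(q)}{1-q}\right],\qquad S_{00,s,x}^{(\alpha)}=[q^x]\,q^sD^{(s)}\left[\sum_{i\ge1}\frac{i^{\alpha-1}q^i}{(1-q)^2}\right],$$ $$S_{4,s,x}^{(\alpha)}=[q^x]\sum_{i\ge1}\mathrm{Sum}_{4,s}(q,i)\,i^{\alpha-1},\qquad S_{8,s,x}^{(\alpha)}=[q^x]\sum_{i\ge1}\mathrm{Sum}_{8,s}(q,i)\,i^{\alpha-1}$$ satisfy, for all integers $x\ge1$, $$L_{s,x}^{(\alpha)}=S_{00,s,x}^{(\alpha)}+S_{4,s,x}^{(\alpha)}+S_{8,s,x}^{(\alpha)}.$$ -/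

import Mathlib

namespace LambertDeriv

/-- The coefficient `C_{4,s}(r, p, m)`, for `0 ≤ r ≤ s`.  (A summand with `k > s - r` has `m > s - r`,
so that it carries the factor `Nat.stirlingFirst (s - r) m = 0`.) -/
def C4 (s r p m : ℕ) : ℤ :=
  ∑ k ∈ Finset.range (m + 1),
    (s.choose r : ℤ) * (Nat.stirlingFirst (s - r) m : ℤ) * (Nat.stirlingSecond m k : ℤ)
      * ((s - r - k).choose p : ℤ) * (-1) ^ (s - r - k + p) * (k.factorial : ℤ) * (r.factorial : ℤ)

/-- The binomial coefficient `a choose (b - c)` with `b - c` taken in the integers: it is `0` when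
`b < c`. -/
def chooseSub (a b c : ℕ) : ℕ := if c ≤ b then a.choose (b - c) else 0

/-- The coefficient `C_{8,s}(r, p, n, w)`, for `0 ≤ r ≤ s` and `0 ≤ n ≤ r + 1`.  (The exponent
`m + m₁ + m₂ - w` is nonnegative wherever the factor `m₂ choose (w - m - m₁)` is nonzero.) -/
def C8 (s r p n w : ℕ) : ℤ :=
  ∑ m ∈ Finset.range (s - r + 1), ∑ k ∈ Finset.range (m + 1),
    ∑ m₁ ∈ Finset.range (r + 1 - n + 1), ∑ m₂ ∈ Finset.range (n + 1),
      (s.choose r : ℤ) * (Nat.stirlingFirst (s - r) m : ℤ) * (Nat.stirlingSecond m k : ℤ)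
        * ((s - r - k).choose p : ℤ) * (Nat.stirlingFirst (r + 1 - n) m₁ : ℤ)
        * (Nat.stirlingFirst n m₂ : ℤ) * (chooseSub m₂ w (m + m₁) : ℤ)
        * (-1) ^ (s - k + p + n + m₁ + m₂) * (k.factorial : ℤ)
        * ((n : ℤ) - 2 - (r : ℤ)) ^ (m + m₁ + m₂ - w)

/-- The component sum `Sum_{4,s}(q, i)`. -/
noncomputable def Sum4 (s : ℕ) (q : ℂ) (i : ℕ) : ℂ :=
  ∑ r ∈ Finset.range (s + 1), ∑ p ∈ Finset.range (s + 1), ∑ m ∈ Finset.range (s + 1),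
    q ^ ((p + 1) * i + r) / (1 - q ^ i) ^ (s - r + 1)
      * ((i : ℂ) ^ (m + 1) / (1 - q) ^ (r + 1) - ((r : ℂ) + 1) * (i : ℂ) ^ m / (1 - q) ^ (r + 2))
      * (C4 s r p m : ℂ)

/-- The component sum `Sum_{8,s}(q, i)`, for `i ≥ 1`. -/
noncomputable def Sum8 (s : ℕ) (q : ℂ) (i : ℕ) : ℂ :=
  ∑ r ∈ Finset.range (s + 1), ∑ p ∈ Finset.range (s + 1), ∑ n ∈ Finset.range (r + 2),
    ∑ w ∈ Finset.range (s + 1),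
      q ^ ((p + 2) * i + n - 1) / (1 - q ^ i) ^ (s - r + 1)
        * ((r.choose n : ℂ) * (1 / (1 - q) ^ (r + 1))
            - ((r + 1).choose n : ℂ) * (1 / (1 - q) ^ (r + 2)))
        * (i : ℂ) ^ w * (C8 s r p n w : ℂ)

/-- The power `i ^ β` of a positive integer with real exponent, as a complex number. -/
noncomputable def ipow (i : ℕ+) (β : ℝ) : ℂ := ((((i : ℕ) : ℝ) ^ β : ℝ) : ℂ)

/-- The term `i ^ α q ^ i / (1 - q ^ i)` of the Lambert series. -/
noncomputable def lambertTerm (α : ℝ) (q : ℂ) (i : ℕ+) : ℂ :=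
  ipow i α * q ^ (i : ℕ) / (1 - q ^ (i : ℕ))

/-- The Lambert series `F_α(q)`. -/
noncomputable def F (α : ℝ) (q : ℂ) : ℂ := ∑' i : ℕ+, lambertTerm α q i

/-- The function `F_α(q) / (1 - q)`. -/
noncomputable def A (α : ℝ) (q : ℂ) : ℂ := 1 / (1 - q) * F α q

/-- The term `i ^ (α - 1) q ^ i / (1 - q) ^ 2`. -/
noncomputable def mainTerm (α : ℝ) (q : ℂ) (i : ℕ+) : ℂ :=
  ipow i (α - 1) * q ^ (i : ℕ) / (1 - q) ^ 2

/-- The function `∑ i ≥ 1, i ^ (α - 1) q ^ i / (1 - q) ^ 2`. -/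
noncomputable def B (α : ℝ) (q : ℂ) : ℂ := ∑' i : ℕ+, mainTerm α q i

/-- The operator `q ^ s D ^ (s)` on functions of `q`. -/
noncomputable def qsDs (s : ℕ) (f : ℂ → ℂ) (q : ℂ) : ℂ := q ^ s * iteratedDeriv s f q

/-- The function `∑ i ≥ 1, Sum_{4,s}(q, i) i ^ (α - 1)`. -/
noncomputable def T4 (s : ℕ) (α : ℝ) (q : ℂ) : ℂ := ∑' i : ℕ+, Sum4 s q i * ipow i (α - 1)

/-- The function `∑ i ≥ 1, Sum_{8,s}(q, i) i ^ (α - 1)`. -/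
noncomputable def T8 (s : ℕ) (α : ℝ) (q : ℂ) : ℂ := ∑' i : ℕ+, Sum8 s q i * ipow i (α - 1)

/-- `[q ^ x] f(q)`: the coefficient of `q ^ x` in the power series of `f` about `0`, for `f`
holomorphic near `0`. -/
noncomputable def coeff (x : ℕ) (f : ℂ → ℂ) : ℂ := iteratedDeriv x f 0 / (x.factorial : ℂ)

/-- `L_{s,x}^{(α)}`. -/
noncomputable def L (α : ℝ) (s x : ℕ) : ℂ := coeff x (qsDs s (A α))

/-- `S_{00,s,x}^{(α)}`. -/
noncomputable def S00 (α : ℝ) (s x : ℕ) : ℂ := coeff x (qsDs s (B α))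

/-- `S_{4,s,x}^{(α)}`. -/
noncomputable def S4 (α : ℝ) (s x : ℕ) : ℂ := coeff x (T4 s α)

/-- `S_{8,s,x}^{(α)}`. -/
noncomputable def S8 (α : ℝ) (s x : ℕ) : ℂ := coeff x (T8 s α)

end LambertDeriv

/-! Everything happens termwise. Put `g = q ^ i / (1 - q ^ i)`. Since `q ^ i = g * (1 - q ^ i)`, the
`i`-th term of `F / (1 - q)` minus the corresponding term of `B` is `i ^ (α - 1)` times `(i / (1 -
q) - 1 / (1 - q) ^ 2 + q ^ i / (1 - q) ^ 2) * g`. The Leibniz rule for `q ^ s D ^ (s)` splits this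
product: the two purely rational summands give `Sum4` (`Sum4_eq`), the summand with `q ^ i` gives
`Sum8` (`Sum8_eq`). The derivatives of `g` follow from `q ^ n D ^ (n) = ∑ (-1) ^ (n + m) [n, m] (q
D) ^ m` together with Stirling numbers of the second kind (`qsDs_geom`); those of `q ^ i / (1 - q) ^
2` have explicit numerators built from falling factorials (`qsDs_main`). The delicate point is the
range of `w`. Expanding the numerators in powers of `i` produces degrees up to `s + 1`, while `Sum8`
stops at `s`; the top coefficient is `(-1) ^ n` times a constant in `n` (`exists_C8_succ_eq`), and
its sum over `n` cancels (`sum_neg_one_pow_eq_zero`). Every series is dominated by polynomial times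
geometric terms on smaller discs, so it may be differentiated termwise
(`SummablyBounded.hasSum_qsDs`). -/

open Finset

namespace LambertDeriv

/-! ### Stirling recurrences, falling factorials and binomial sums. -/

theorem sum_stirlingFirst_succ_mul {R : Type*} [CommRing R] (n : ℕ) (g : ℕ → R) :
    ∑ m ∈ range (n + 2), (Nat.stirlingFirst (n + 1) m : R) * g m
      = ∑ m ∈ range (n + 1), (Nat.stirlingFirst n m : R) * (g (m + 1) + n * g m) := by
  have h0 : (n : R) * (Nat.stirlingFirst n 0 : R) = 0 := by
    cases n <;> simp
  have h1 : ∑ m ∈ range (n + 1), (n : R) * ((Nat.stirlingFirst n (m + 1) : R) * g (m + 1))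
      = ∑ m ∈ range (n + 1), (n : R) * ((Nat.stirlingFirst n m : R) * g m) := by
    have h2 := Finset.sum_range_succ' (fun m => (n : R) * ((Nat.stirlingFirst n m : R) * g m)) (n + 1)
    rw [Finset.sum_range_succ, Nat.stirlingFirst_eq_zero_of_lt (Nat.lt_succ_self n),
      ← mul_assoc (n : R) _ (g 0), h0] at h2
    simpa using h2.symm
  rw [Finset.sum_range_succ', Nat.stirlingFirst_succ_zero]
  simp only [Nat.stirlingFirst_succ_succ, Nat.cast_add, Nat.cast_mul, add_mul, mul_add,
    Finset.sum_add_distrib, Nat.cast_zero, zero_mul, add_zero]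
  rw [add_comm]
  congr 1
  simp only [mul_assoc, h1]
  exact Finset.sum_congr rfl fun m _ => by ring

/-- Like its first-kind analogue, this is the Stirling recurrence summed against a test function,
the form in which inductions on an operator power use it. -/
theorem sum_stirlingSecond_succ_mul {R : Type*} [CommRing R] (n : ℕ) (g : ℕ → R) :
    ∑ k ∈ range (n + 2), (Nat.stirlingSecond (n + 1) k : R) * g k
      = ∑ k ∈ range (n + 1), (Nat.stirlingSecond n k : R) * (k * g k + g (k + 1)) := by
  have h1 : ∑ k ∈ range (n + 1), (Nat.stirlingSecond n (k + 1) : R) * ((k + 1 : ℕ) * g (k + 1))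
      = ∑ k ∈ range (n + 1), (Nat.stirlingSecond n k : R) * (k * g k) := by
    have h2 := Finset.sum_range_succ' (fun k => (Nat.stirlingSecond n k : R) * (k * g k)) (n + 1)
    rw [Finset.sum_range_succ, Nat.stirlingSecond_eq_zero_of_lt (Nat.lt_succ_self n)] at h2
    simpa using h2.symm
  rw [Finset.sum_range_succ', Nat.stirlingSecond_succ_zero]
  simp only [mul_add, Finset.sum_add_distrib, ← h1]
  rw [← Finset.sum_add_distrib]
  simp only [Nat.cast_zero, zero_mul, add_zero]
  refine Finset.sum_congr rfl fun k _ => ?_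
  rw [Nat.stirlingSecond_succ_succ]
  push_cast
  ring

/-- The falling factorial `x (x - 1) ⋯ (x - n + 1)`. -/
noncomputable def falling (n : ℕ) (x : ℂ) : ℂ := (descPochhammer ℂ n).eval x

@[simp]
theorem falling_zero (x : ℂ) : falling 0 x = 1 := by simp [falling]

theorem falling_succ (n : ℕ) (x : ℂ) : falling (n + 1) x = falling n x * (x - n) :=
  descPochhammer_succ_eval n x

theorem falling_succ_left (n : ℕ) (x : ℂ) : falling (n + 1) x = x * falling n (x - 1) := by
  simp [falling, descPochhammer_succ_left]

theorem sum_stirlingFirst_mul_pow (n : ℕ) (x : ℂ) :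
    ∑ m ∈ range (n + 1), (Nat.stirlingFirst n m : ℂ) * ((-1) ^ (n + m) * x ^ m)
      = falling n x := by
  induction n with
  | zero => simp
  | succ n ih =>
    rw [sum_stirlingFirst_succ_mul, falling_succ, ← ih, Finset.sum_mul]
    exact Finset.sum_congr rfl fun m _ => by ring

/-- A shifted binomial theorem: terms with `w < c` or `w > c + a` vanish, so the truncated exponent
`c + a - w` is harmless. -/
theorem sum_chooseSub_mul (a c W : ℕ) (h : c + a < W) (x z : ℂ) :
    ∑ w ∈ range W, (chooseSub a w c : ℂ) * x ^ w * z ^ (c + a - w) = x ^ c * (x + z) ^ a := by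
  obtain ⟨d, rfl⟩ : ∃ d, W = c + (a + 1 + d) := ⟨W - c - a - 1, by omega⟩
  rw [Finset.sum_range_add, Finset.sum_eq_zero, zero_add, Finset.sum_range_add, add_comm,
    Finset.sum_eq_zero, zero_add, add_pow, Finset.mul_sum]
  · refine Finset.sum_congr rfl fun j _ => ?_
    rw [chooseSub, if_pos (Nat.le_add_right c j), Nat.add_sub_cancel_left, Nat.add_sub_add_left,
      pow_add]
    ring
  · intro j _
    rw [chooseSub, if_pos (Nat.le_add_right _ _), Nat.choose_eq_zero_of_lt (by omega)]
    simp
  · intro w hw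
    rw [chooseSub, if_neg (by simpa using hw)]
    simp

theorem sum_choose_mul_neg_pow (M s : ℕ) (h : M ≤ s) (u : ℂ) :
    ∑ p ∈ range (s + 1), (M.choose p : ℂ) * (-1) ^ p * u ^ p = (1 - u) ^ M := by
  obtain ⟨d, rfl⟩ := Nat.exists_eq_add_of_le h
  rw [show M + d + 1 = M + 1 + d by ring, Finset.sum_range_add, sub_eq_neg_add, add_pow,
    add_eq_left.2]
  · refine Finset.sum_congr rfl fun j _ => ?_
    rw [neg_pow u]
    ring
  · refine Finset.sum_eq_zero fun j _ => ?_
    rw [Nat.choose_eq_zero_of_lt (by omega)]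
    simp

/-! ### Summing out the coefficients `C4` and `C8`. -/

/-- The expansion of `q ^ n D ^ (n)` applied to `u / (1 - u)` with `u = q ^ i`. -/
noncomputable def geomDeriv (n : ℕ) (i u : ℂ) : ℂ :=
  ∑ m ∈ range (n + 1), ∑ k ∈ range (m + 1),
    (Nat.stirlingFirst n m : ℂ) * (Nat.stirlingSecond m k : ℂ) * (k.factorial : ℂ)
      * (-1) ^ (n - k) * i ^ m * (u / (1 - u) ^ (k + 1))

theorem div_one_sub_pow_eq {n k : ℕ} (hk : k ≤ n) {u : ℂ} (hu : 1 - u ≠ 0) :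
    u * (1 - u) ^ (n - k) / (1 - u) ^ (n + 1) = u / (1 - u) ^ (k + 1) := by
  rw [div_eq_div_iff (pow_ne_zero _ hu) (pow_ne_zero _ hu), mul_assoc, ← pow_add]
  congr 2
  omega

/-- The sum over `p` is the binomial expansion of `(1 - u) ^ (s - r - k)`, which lowers the common
denominator exponent to `k + 1`. -/
theorem sum_C4 {s r : ℕ} (hr : r ≤ s) {i u : ℂ} (hu : 1 - u ≠ 0) :
    ∑ p ∈ range (s + 1), ∑ m ∈ range (s + 1),
        u ^ (p + 1) / (1 - u) ^ (s - r + 1) * i ^ m * (C4 s r p m : ℂ)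
      = (s.choose r : ℂ) * (r.factorial : ℂ) * geomDeriv (s - r) i u := by
  have hN : range (s - r + 1) ⊆ range (s + 1) := by
    intro x; simp only [mem_range]; omega
  rw [Finset.sum_comm, ← Finset.sum_subset hN, geomDeriv, Finset.mul_sum]
  · refine Finset.sum_congr rfl fun m hm => ?_
    simp only [C4, Int.cast_sum, Finset.mul_sum]
    rw [Finset.sum_comm]
    refine Finset.sum_congr rfl fun k hk => ?_
    have hks : k ≤ s - r := by simp only [mem_range] at hm hk; omega
    rw [← div_one_sub_pow_eq hks hu, ← sum_choose_mul_neg_pow (s - r - k) s (by omega),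
      Finset.mul_sum, Finset.sum_div, Finset.mul_sum, Finset.mul_sum]
    refine Finset.sum_congr rfl fun p _ => ?_
    push_cast
    ring
  · intro m _ hm
    refine Finset.sum_eq_zero fun p _ => ?_
    rw [C4, Finset.sum_eq_zero]
    · simp
    · intro k _
      rw [Nat.stirlingFirst_eq_zero_of_lt (by simpa using hm)]
      simp

theorem sum_C8 {s r n : ℕ} (hr : r ≤ s) (hn : n ≤ r + 1) {i u : ℂ} (hu : 1 - u ≠ 0) :
    ∑ p ∈ range (s + 1), ∑ w ∈ range (s + 2),
        u ^ (p + 1) / (1 - u) ^ (s - r + 1) * i ^ w * (C8 s r p n w : ℂ)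
      = (s.choose r : ℂ) * geomDeriv (s - r) i u
        * (-(-1) ^ n * (falling (r + 1 - n) i * falling n (i + n - 2 - r))) := by
  rw [← Finset.sum_product', ← sum_stirlingFirst_mul_pow, ← sum_stirlingFirst_mul_pow,
    Finset.sum_mul_sum, geomDeriv]
  conv_lhs => simp only [C8, Int.cast_sum, Finset.mul_sum]
  rw [Finset.sum_comm, Finset.mul_sum, Finset.sum_mul]
  refine Finset.sum_congr rfl fun m hm => ?_
  rw [Finset.sum_comm, Finset.mul_sum, Finset.sum_mul]
  refine Finset.sum_congr rfl fun k hk => ?_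
  rw [Finset.sum_comm, Finset.mul_sum, Finset.mul_sum]
  refine Finset.sum_congr rfl fun m₁ hm₁ => ?_
  rw [Finset.sum_comm, Finset.mul_sum, Finset.mul_sum]
  refine Finset.sum_congr rfl fun m₂ hm₂ => ?_
  simp only [mem_range] at hm hk hm₁ hm₂
  have hks : k ≤ s - r := by omega
  -- The range `s + 2` suffices because `m + m₁ + m₂ ≤ (s - r) + (r + 1 - n) + n = s + 1`.
  have hw := sum_chooseSub_mul m₂ (m + m₁) (s + 2) (by omega) i ((n : ℂ) - 2 - r)
  have hs1 : ((-1 : ℂ)) ^ (s - k) = (-1) ^ (s - r - k) * (-1) ^ r := by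
    rw [← pow_add]; congr 1; omega
  have h2 : ((-1 : ℂ)) ^ n * (-1) ^ n = 1 := by rw [← mul_pow]; simp
  have hs2 : ((-1 : ℂ)) ^ (r + 1 - n) = - ((-1) ^ r * (-1) ^ n) := by
    have h := pow_add (-1 : ℂ) (r + 1 - n) n
    rw [Nat.sub_add_cancel hn, pow_succ] at h
    linear_combination (-(-1) ^ n) * h - (-1) ^ (r + 1 - n) * h2
  have hx : i + (n : ℂ) - 2 - r = i + ((n : ℂ) - 2 - r) := by ring
  rw [← div_one_sub_pow_eq hks hu, hx, ← sum_choose_mul_neg_pow (s - r - k) s (by omega)]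
  trans ((s.choose r : ℂ) * (Nat.stirlingFirst (s - r) m : ℂ) * (Nat.stirlingSecond m k : ℂ)
        * (Nat.stirlingFirst (r + 1 - n) m₁ : ℂ)
        * (Nat.stirlingFirst n m₂ : ℂ) * (k.factorial : ℂ)
        * ((-1) ^ (s - k) * (-1) ^ n * (-1) ^ m₁ * (-1) ^ m₂)) *
      (u * (∑ p ∈ range (s + 1), ((s - r - k).choose p : ℂ) * (-1) ^ p * u ^ p)
        / (1 - u) ^ (s - r + 1)) * (i ^ (m + m₁) * (i + ((n : ℂ) - 2 - r)) ^ m₂)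
  · rw [← hw, Finset.sum_product, Finset.mul_sum (range (s + 1)) _ u, Finset.sum_div,
      Finset.mul_sum (range (s + 1)), Finset.sum_mul_sum]
    refine Finset.sum_congr rfl fun p _ => Finset.sum_congr rfl fun w _ => ?_
    push_cast
    ring
  -- The two falling factorials contribute the sign `(-1) ^ (r + 1 + m₁ + m₂)`; the prefactor `-(-1)
  -- ^ n` turns it into the sign in `C8`.
  · have hs3 : -(-1 : ℂ) ^ n * ((-1) ^ (r + 1 - n + m₁) * (-1) ^ (n + m₂))
        = (-1) ^ r * (-1) ^ n * (-1) ^ m₁ * (-1) ^ m₂ := by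
      rw [pow_add _ (r + 1 - n), hs2, pow_add _ n]
      linear_combination ((-1) ^ r * (-1) ^ n * (-1) ^ m₁ * (-1) ^ m₂) * h2
    rw [hs1, pow_add i]
    generalize ∑ p ∈ range (s + 1), ((s - r - k).choose p : ℂ) * (-1) ^ p * u ^ p = P
    generalize u * P / (1 - u) ^ (s - r + 1) = Q
    linear_combination (-((s.choose r : ℂ) * (Nat.stirlingFirst (s - r) m : ℂ)
      * (Nat.stirlingSecond m k : ℂ) * (Nat.stirlingFirst (r + 1 - n) m₁ : ℂ)
      * (Nat.stirlingFirst n m₂ : ℂ) * (k.factorial : ℂ) * (-1) ^ (s - r - k) * Q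
      * (i ^ m * i ^ m₁ * (i + ((n : ℂ) - 2 - r)) ^ m₂))) * hs3

/-- Degree `s + 1` is attained only at the top indices `m = s - r`, `m₁ = r + 1 - n`, `m₂ = n`,
where the Stirling numbers of the first kind are `1` and the power of `n - 2 - r` has exponent `0`.
Only the sign then depends on `n`. -/
theorem exists_C8_succ_eq {s r : ℕ} (hr : r ≤ s) (p : ℕ) :
    ∃ K : ℤ, ∀ n ≤ r + 1, C8 s r p n (s + 1) = (-1) ^ n * K := by
  refine ⟨∑ k ∈ range (s - r + 1), (s.choose r : ℤ) * (Nat.stirlingSecond (s - r) k : ℤ)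
        * ((s - r - k).choose p : ℤ) * (-1) ^ (s - k + p + r + 1) * (k.factorial : ℤ),
    fun n hn => ?_⟩
  have hz : ∀ {m m₁ m₂ : ℕ}, m + m₁ + m₂ < s + 1 → chooseSub m₂ (s + 1) (m + m₁) = 0 := by
    intro m m₁ m₂ h
    rw [chooseSub, if_pos (by omega), Nat.choose_eq_zero_of_lt (by omega)]
  rw [C8, Finset.sum_eq_single (s - r), Finset.mul_sum]
  · refine Finset.sum_congr rfl fun k _ => ?_
    rw [Finset.sum_eq_single (r + 1 - n), Finset.sum_eq_single n]
    · have h1 : chooseSub n (s + 1) (s - r + (r + 1 - n)) = 1 := by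
        rw [chooseSub, if_pos (by omega), show s + 1 - (s - r + (r + 1 - n)) = n by omega,
          Nat.choose_self]
      have h2 : s - k + p + n + (r + 1 - n) + n = s - k + p + r + 1 + n := by omega
      have h3 : s - r + (r + 1 - n) + n - (s + 1) = 0 := by omega
      rw [h1, h2, h3, Nat.stirlingFirst_self, Nat.stirlingFirst_self, Nat.stirlingFirst_self]
      push_cast
      ring
    · intro m₂ h h'
      rw [mem_range] at h
      rw [hz (by omega)]
      simp
    · simp
    · intro m₁ h h'
      refine Finset.sum_eq_zero fun m₂ h'' => ?_
      rw [mem_range] at h h''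
      rw [hz (by omega)]
      simp
    · simp
  · intro m h h'
    refine Finset.sum_eq_zero fun k _ => Finset.sum_eq_zero fun m₁ h1 =>
      Finset.sum_eq_zero fun m₂ h2 => ?_
    rw [mem_range] at h h1 h2
    rw [hz (by omega)]
    simp
  · simp

/-! ### Calculus of the Euler operator `q D` and of `q ^ n D ^ (n)`. -/

/-- `q f'(q) = e`, with `f` differentiable at `q`. -/
def HasEulerDerivAt (f : ℂ → ℂ) (e q : ℂ) : Prop := ∃ d, HasDerivAt f d q ∧ q * d = e

namespace HasEulerDerivAt

variable {f g : ℂ → ℂ} {e e' q : ℂ}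

theorem mul (hf : HasEulerDerivAt f e q) (hg : HasEulerDerivAt g e' q) :
    HasEulerDerivAt (fun x => f x * g x) (e * g q + f q * e') q := by
  obtain ⟨d, hd, rfl⟩ := hf
  obtain ⟨d', hd', rfl⟩ := hg
  exact ⟨_, hd.mul hd', by ring⟩

theorem sub (hf : HasEulerDerivAt f e q) (hg : HasEulerDerivAt g e' q) :
    HasEulerDerivAt (fun x => f x - g x) (e - e') q := by
  obtain ⟨d, hd, rfl⟩ := hf
  obtain ⟨d', hd', rfl⟩ := hg
  exact ⟨_, hd.sub hd', by ring⟩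

theorem const_mul (c : ℂ) (hf : HasEulerDerivAt f e q) :
    HasEulerDerivAt (fun x => c * f x) (c * e) q := by
  obtain ⟨d, hd, rfl⟩ := hf
  exact ⟨_, hd.const_mul c, by ring⟩

theorem sum {ι : Type*} {t : Finset ι} {f : ι → ℂ → ℂ} {e : ι → ℂ}
    (h : ∀ i ∈ t, HasEulerDerivAt (f i) (e i) q) :
    HasEulerDerivAt (fun x => ∑ i ∈ t, f i x) (∑ i ∈ t, e i) q := by
  choose! d hd he using h
  exact ⟨_, HasDerivAt.fun_sum hd, by rw [Finset.mul_sum]; exact Finset.sum_congr rfl he⟩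

theorem pow (n : ℕ) (q : ℂ) : HasEulerDerivAt (fun x => x ^ n) (n * q ^ n) q := by
  refine ⟨_, hasDerivAt_pow n q, ?_⟩
  cases n with
  | zero => simp
  | succ n => rw [Nat.add_sub_cancel]; ring

theorem comp_pow (n : ℕ) (hf : HasEulerDerivAt f e (q ^ n)) :
    HasEulerDerivAt (fun x => f (x ^ n)) (n * e) q := by
  obtain ⟨d, hd, rfl⟩ := hf
  obtain ⟨d', hd', h⟩ := pow n q
  exact ⟨_, hd.comp q hd', by linear_combination d * h⟩

theorem one_div_one_sub_pow (b : ℕ) (hq : 1 - q ≠ 0) :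
    HasEulerDerivAt (fun x => 1 / (1 - x) ^ b) (b * q / (1 - q) ^ (b + 1)) q := by
  have h1 : HasDerivAt (fun x : ℂ => 1 - x) (-1) q := by
    simpa using (hasDerivAt_id q).const_sub 1
  refine ⟨_, (hasDerivAt_const q (1 : ℂ)).div (h1.pow b) (pow_ne_zero _ hq), ?_⟩
  cases b with
  | zero => simp
  | succ b =>
    simp only [Nat.add_sub_cancel]
    field_simp
    ring

end HasEulerDerivAt

theorem one_sub_ne_zero {q : ℂ} (hq : q ∈ Metric.ball (0 : ℂ) 1) : 1 - q ≠ 0 := by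
  intro h
  rw [← sub_eq_zero.1 h] at hq
  simp at hq

theorem pow_mem_ball {q : ℂ} (hq : q ∈ Metric.ball (0 : ℂ) 1) {i : ℕ} (hi : i ≠ 0) :
    q ^ i ∈ Metric.ball (0 : ℂ) 1 := by
  rw [mem_ball_zero_iff] at hq ⊢
  rw [norm_pow]
  exact pow_lt_one₀ (norm_nonneg _) hq hi

theorem analyticAt_of_ball {f : ℂ → ℂ} (hf : DifferentiableOn ℂ f (Metric.ball 0 1)) {q : ℂ}
    (hq : q ∈ Metric.ball (0 : ℂ) 1) : AnalyticAt ℂ f q :=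
  hf.analyticAt (Metric.isOpen_ball.mem_nhds hq)

theorem qsDs_succ {f : ℂ → ℂ} (hf : DifferentiableOn ℂ f (Metric.ball 0 1)) (n : ℕ) {q : ℂ}
    (hq : q ∈ Metric.ball (0 : ℂ) 1) :
    qsDs (n + 1) f q = q * deriv (qsDs n f) q - n * qsDs n f q := by
  have h1 : DifferentiableAt ℂ (iteratedDeriv n f) q := by
    rw [iteratedDeriv_eq_iterate]
    exact ((analyticAt_of_ball hf hq).iterated_deriv n).differentiableAt
  obtain ⟨d, hd, he⟩ := HasEulerDerivAt.pow n q
  have h2 : HasDerivAt (qsDs n f) _ q := hd.mul h1.hasDerivAt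
  rw [h2.deriv, qsDs, qsDs, iteratedDeriv_succ]
  linear_combination -(iteratedDeriv n f q) * he

/-- Since `q ^ (n + 1) D ^ (n + 1) = (q D - n) q ^ n D ^ (n)`, a proposed closed form needs checking
only against one application of `q D`. -/
theorem qsDs_eq_of_hasEulerDerivAt {f : ℂ → ℂ} (hf : DifferentiableOn ℂ f (Metric.ball 0 1))
    {E : ℕ → ℂ → ℂ} (h0 : ∀ q ∈ Metric.ball (0 : ℂ) 1, f q = E 0 q)
    (hE : ∀ n, ∀ q ∈ Metric.ball (0 : ℂ) 1,
      HasEulerDerivAt (E n) (E (n + 1) q + n * E n q) q) (n : ℕ) :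
    ∀ q ∈ Metric.ball (0 : ℂ) 1, qsDs n f q = E n q := by
  induction n with
  | zero => intro q hq; simp [qsDs, h0 q hq]
  | succ n ih =>
    intro q hq
    have h1 : qsDs n f =ᶠ[nhds q] E n := by
      filter_upwards [Metric.isOpen_ball.mem_nhds hq] with z hz using ih z hz
    obtain ⟨d, hd, he⟩ := hE n q hq
    rw [qsDs_succ hf n hq, h1.deriv_eq, hd.deriv, ih q hq, he]
    ring

theorem qsDs_add {f g : ℂ → ℂ} (hf : DifferentiableOn ℂ f (Metric.ball 0 1))
    (hg : DifferentiableOn ℂ g (Metric.ball 0 1)) (n : ℕ) {q : ℂ}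
    (hq : q ∈ Metric.ball (0 : ℂ) 1) :
    qsDs n (fun x => f x + g x) q = qsDs n f q + qsDs n g q := by
  rw [qsDs, iteratedDeriv_fun_add (analyticAt_of_ball hf hq).contDiffAt
    (analyticAt_of_ball hg hq).contDiffAt, mul_add]
  rfl

theorem qsDs_mul {f g : ℂ → ℂ} (hf : DifferentiableOn ℂ f (Metric.ball 0 1))
    (hg : DifferentiableOn ℂ g (Metric.ball 0 1)) (n : ℕ) {q : ℂ}
    (hq : q ∈ Metric.ball (0 : ℂ) 1) :
    qsDs n (fun x => f x * g x) q
      = ∑ r ∈ range (n + 1), (n.choose r : ℂ) * (qsDs r f q * qsDs (n - r) g q) := by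
  rw [qsDs, iteratedDeriv_fun_mul (analyticAt_of_ball hf hq).contDiffAt
    (analyticAt_of_ball hg hq).contDiffAt, Finset.mul_sum]
  refine Finset.sum_congr rfl fun r hr => ?_
  have h : q ^ n = q ^ r * q ^ (n - r) := by
    rw [← pow_add, Nat.add_sub_cancel' (by simpa [Nat.lt_succ_iff] using hr)]
  rw [qsDs, qsDs, h]
  ring

/-! ### Closed forms for the derivatives of the three factors. -/

/-- The expansion of `(q D) ^ m` applied to `u / (1 - u)` with `u = q ^ i`. -/
noncomputable def geomTheta (m : ℕ) (i u : ℂ) : ℂ :=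
  i ^ m * ∑ k ∈ range (m + 1), (Nat.stirlingSecond m k : ℂ)
    * ((-1) ^ (m + k) * k.factorial * (u * (1 / (1 - u) ^ (k + 1))))

theorem geomDeriv_eq (n : ℕ) (i u : ℂ) :
    geomDeriv n i u
      = ∑ m ∈ range (n + 1), (Nat.stirlingFirst n m : ℂ) * ((-1) ^ (n + m) * geomTheta m i u) := by
  refine Finset.sum_congr rfl fun m hm => ?_
  rw [geomTheta, Finset.mul_sum, Finset.mul_sum, Finset.mul_sum]
  refine Finset.sum_congr rfl fun k hk => ?_
  rw [mem_range] at hm hk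
  have h : ((-1 : ℂ)) ^ (n - k) = (-1) ^ (n + m) * (-1) ^ (m + k) := by
    have h' : n + m + (m + k) = n - k + 2 * (m + k) := by omega
    rw [← pow_add, h', pow_add, pow_mul]
    simp
  rw [h]
  ring

theorem hasEulerDerivAt_geomTheta (m i : ℕ) {q : ℂ} (hq : 1 - q ^ i ≠ 0) :
    HasEulerDerivAt (fun x => geomTheta m i (x ^ i)) (geomTheta (m + 1) i (q ^ i)) q := by
  -- Writing `u = 1 - (1 - u)` keeps the result in the span of the `u / (1 - u) ^ (k + 1)`; its
  -- coefficients `k + 1` and `-k` match the second-kind recurrence.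
  have h1 : ∀ k : ℕ, HasEulerDerivAt (fun u => u * (1 / (1 - u) ^ (k + 1)))
      ((k + 1) * (q ^ i * (1 / (1 - q ^ i) ^ (k + 2)))
        - k * (q ^ i * (1 / (1 - q ^ i) ^ (k + 1)))) (q ^ i) := by
    intro k
    have h := (HasEulerDerivAt.pow 1 (q ^ i)).mul
      (HasEulerDerivAt.one_div_one_sub_pow (k + 1) hq)
    simp only [pow_one] at h
    convert! h using 1
    push_cast
    field_simp
    ring
  have h2 : HasEulerDerivAt (fun u => geomTheta m i u) _ (q ^ i) :=
    (HasEulerDerivAt.sum (t := range (m + 1)) fun k _ => ((h1 k).const_mul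
      ((-1) ^ (m + k) * k.factorial)).const_mul (Nat.stirlingSecond m k : ℂ)).const_mul _
  convert! h2.comp_pow i using 1
  rw [geomTheta, sum_stirlingSecond_succ_mul, pow_succ', mul_assoc]
  congr 2
  refine Finset.sum_congr rfl fun k _ => ?_
  rw [Nat.factorial_succ]
  push_cast
  ring

theorem differentiableOn_geom (i : ℕ) (hi : i ≠ 0) :
    DifferentiableOn ℂ (fun q : ℂ => q ^ i / (1 - q ^ i)) (Metric.ball 0 1) := by
  refine DifferentiableOn.div (by fun_prop) (by fun_prop) fun q hq => ?_
  exact one_sub_ne_zero (pow_mem_ball hq hi)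

theorem qsDs_geom (n : ℕ) {i : ℕ} (hi : i ≠ 0) {q : ℂ} (hq : q ∈ Metric.ball (0 : ℂ) 1) :
    qsDs n (fun x => x ^ i / (1 - x ^ i)) q = geomDeriv n i (q ^ i) := by
  refine qsDs_eq_of_hasEulerDerivAt (differentiableOn_geom i hi)
    (E := fun n q => geomDeriv n i (q ^ i)) (fun q _ => by simp [geomDeriv]) ?_ n q hq
  intro n q hq
  have hq' := one_sub_ne_zero (pow_mem_ball hq hi)
  simp only [geomDeriv_eq]
  convert! HasEulerDerivAt.sum (t := range (n + 1)) fun m _ =>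
    ((hasEulerDerivAt_geomTheta m i hq').const_mul ((-1) ^ (n + m))).const_mul
      (Nat.stirlingFirst n m : ℂ) using 1
  rw [sum_stirlingFirst_succ_mul, Finset.mul_sum, ← Finset.sum_add_distrib]
  exact Finset.sum_congr rfl fun m _ => by ring

theorem differentiableOn_rational (x : ℂ) :
    DifferentiableOn ℂ (fun q : ℂ => x / (1 - q) - 1 / (1 - q) ^ 2) (Metric.ball 0 1) :=
  (DifferentiableOn.div (by fun_prop) (by fun_prop) fun q hq => one_sub_ne_zero hq).sub
    (DifferentiableOn.div (by fun_prop) (by fun_prop) fun q hq =>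
      pow_ne_zero _ (one_sub_ne_zero hq))

theorem qsDs_rational (n : ℕ) (x : ℂ) {q : ℂ} (hq : q ∈ Metric.ball (0 : ℂ) 1) :
    qsDs n (fun q => x / (1 - q) - 1 / (1 - q) ^ 2) q
      = q ^ n * (x * n.factorial / (1 - q) ^ (n + 1)
          - (n + 1).factorial / (1 - q) ^ (n + 2)) := by
  have key := qsDs_eq_of_hasEulerDerivAt (differentiableOn_rational x)
    (E := fun n q => q ^ n * (x * n.factorial * (1 / (1 - q) ^ (n + 1))
          - (n + 1).factorial * (1 / (1 - q) ^ (n + 2)))) (fun q _ => ?_) ?_ n q hq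
  · rw [key]; ring
  · simp; ring
  · intro n q hq
    have hq' := one_sub_ne_zero hq
    have h := (HasEulerDerivAt.pow n q).mul
      (((HasEulerDerivAt.one_div_one_sub_pow (n + 1) hq').const_mul (x * n.factorial)).sub
        ((HasEulerDerivAt.one_div_one_sub_pow (n + 2) hq').const_mul
          ((n + 1).factorial : ℂ)))
    convert! h using 1
    rw [Nat.factorial_succ (n + 1), Nat.factorial_succ n]
    push_cast
    field_simp
    ring

/-- The coefficients of the numerator of `q ^ r D ^ (r)` applied to `q ^ i / (1 - q) ^ 2`. -/
noncomputable def numCoeff (i : ℂ) (r n : ℕ) : ℂ :=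
  (-1) ^ n * r.choose n * falling (r - n) i * falling n (i - r - 2 + n)

theorem numCoeff_succ_zero (i : ℂ) (r : ℕ) :
    numCoeff i (r + 1) 0 = (i - r) * numCoeff i r 0 := by
  simp [numCoeff, falling_succ]
  ring

/-- After the common falling factors are removed, Pascal's rule and `(n + 1) * r.choose (n + 1) = (r
- n) * r.choose n` leave a polynomial identity. -/
theorem numCoeff_succ_succ (i : ℂ) {r n : ℕ} (hn : n ≤ r) :
    numCoeff i (r + 1) (n + 1)
      = (i - r + (n + 1)) * numCoeff i r (n + 1) + (2 * r + 2 - i - n) * numCoeff i r n := by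
  obtain ⟨d, rfl⟩ := Nat.exists_eq_add_of_le hn
  have hx : i - (n + d : ℕ) - 2 + (n + 1 : ℕ) - 1 = i - (n + d : ℕ) - 2 + n := by push_cast; ring
  have hy : i - (n + d + 1 : ℕ) - 2 + (n + 1 : ℕ) = i - (n + d : ℕ) - 2 + n := by push_cast; ring
  rw [numCoeff, numCoeff, numCoeff, falling_succ_left n (i - (n + d : ℕ) - 2 + (n + 1 : ℕ)), hx,
    hy, falling_succ]
  have hc : ((n + d).choose (n + 1) : ℂ) * (n + 1) = (n + d).choose n * d := by
    have := Nat.choose_succ_right_eq (n + d) n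
    rw [Nat.add_sub_cancel_left] at this
    exact_mod_cast this
  have h1 : n + d + 1 - (n + 1) = d := by omega
  have h2 : n + d - n = d := by omega
  rw [Nat.choose_succ_succ', h1, h2]
  generalize falling n (i - (n + d : ℕ) - 2 + n) = P
  -- For `d = 0` the index `r - (n + 1)` is truncated, but its binomial coefficient vanishes.
  cases d with
  | zero =>
    simp
    ring
  | succ d =>
    have h3 : n + (d + 1) - (n + 1) = d := by omega
    rw [h3, falling_succ]
    push_cast at hc ⊢
    linear_combination (falling d i * P * (-1) ^ n * (i - d)) * hc

theorem differentiableOn_main (i : ℕ) :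
    DifferentiableOn ℂ (fun q : ℂ => q ^ i / (1 - q) ^ 2) (Metric.ball 0 1) :=
  DifferentiableOn.div (by fun_prop) (by fun_prop) fun q hq =>
      pow_ne_zero _ (one_sub_ne_zero hq)

theorem qsDs_main (n i : ℕ) {q : ℂ} (hq : q ∈ Metric.ball (0 : ℂ) 1) :
    qsDs n (fun q => q ^ i / (1 - q) ^ 2) q
      = ∑ k ∈ range (n + 1), numCoeff i n k * (q ^ (i + k) * (1 / (1 - q) ^ (n + 2))) := by
  refine qsDs_eq_of_hasEulerDerivAt (differentiableOn_main i)
    (E := fun n q => ∑ k ∈ range (n + 1),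
      numCoeff i n k * (q ^ (i + k) * (1 / (1 - q) ^ (n + 2))))
    (fun q _ => by simp [numCoeff]; ring) ?_ n q hq
  intro n q hq
  have hq' := one_sub_ne_zero hq
  convert! HasEulerDerivAt.sum (t := range (n + 1)) fun k _ =>
    ((HasEulerDerivAt.pow (i + k) q).mul
      (HasEulerDerivAt.one_div_one_sub_pow (n + 2) hq')).const_mul (numCoeff i n k) using 1
  have hz : numCoeff i n (n + 1) = 0 := by simp [numCoeff]
  have h1 : ∑ k ∈ range (n + 1), ((i : ℂ) - n + (k + 1)) * numCoeff i n (k + 1)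
        * (q ^ (i + (k + 1)) * (1 / (1 - q) ^ (n + 1 + 2)))
      + (i - n) * numCoeff i n 0 * (q ^ i * (1 / (1 - q) ^ (n + 1 + 2)))
      = ∑ k ∈ range (n + 1), ((i : ℂ) - n + k) * numCoeff i n k
        * (q ^ (i + k) * (1 / (1 - q) ^ (n + 1 + 2))) := by
    have h2 := Finset.sum_range_succ' (fun k : ℕ => ((i : ℂ) - n + k) * numCoeff i n k
        * (q ^ (i + k) * (1 / (1 - q) ^ (n + 1 + 2)))) (n + 1)
    rw [Finset.sum_range_succ, hz] at h2
    push_cast at h2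
    simpa using h2.symm
  have h3 : ∑ k ∈ range (n + 1), numCoeff i (n + 1) (k + 1)
        * (q ^ (i + (k + 1)) * (1 / (1 - q) ^ (n + 1 + 2)))
      = ∑ k ∈ range (n + 1), ((i : ℂ) - n + (k + 1)) * numCoeff i n (k + 1)
        * (q ^ (i + (k + 1)) * (1 / (1 - q) ^ (n + 1 + 2)))
      + ∑ k ∈ range (n + 1), (2 * (n : ℂ) + 2 - i - k) * numCoeff i n k
        * (q ^ (i + (k + 1)) * (1 / (1 - q) ^ (n + 1 + 2))) := by
    rw [← Finset.sum_add_distrib]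
    refine Finset.sum_congr rfl fun k hk => ?_
    rw [numCoeff_succ_succ _ (by simpa [Nat.lt_succ_iff] using hk)]
    ring
  rw [Finset.sum_range_succ', h3, numCoeff_succ_zero, add_zero]
  trans (∑ k ∈ range (n + 1), ((i : ℂ) - n + k) * numCoeff i n k
        * (q ^ (i + k) * (1 / (1 - q) ^ (n + 1 + 2))))
      + ∑ k ∈ range (n + 1), (2 * (n : ℂ) + 2 - i - k) * numCoeff i n k
        * (q ^ (i + (k + 1)) * (1 / (1 - q) ^ (n + 1 + 2)))
      + n * ∑ k ∈ range (n + 1), numCoeff i n k * (q ^ (i + k) * (1 / (1 - q) ^ (n + 2)))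
  · linear_combination h1
  · rw [← Finset.sum_add_distrib, Finset.mul_sum, ← Finset.sum_add_distrib]
    refine Finset.sum_congr rfl fun k _ => ?_
    push_cast
    field_simp
    ring

/-- The left side is the shape occurring in `Sum8`, with two denominators and `n ≤ r + 1`; it
collapses to the numerator of `qsDs_main`. -/
theorem sum_falling_eq {i : ℕ} (hi : i ≠ 0) (r : ℕ) {q : ℂ} (hq : 1 - q ≠ 0) :
    ∑ n ∈ range (r + 2), q ^ (i + n - 1)
        * ((r.choose n : ℂ) * (1 / (1 - q) ^ (r + 1))
            - ((r + 1).choose n : ℂ) * (1 / (1 - q) ^ (r + 2)))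
        * (-(-1) ^ n * (falling (r + 1 - n) i * falling n (i + n - 2 - r)))
      = ∑ k ∈ range (r + 1), numCoeff i r k * (q ^ (i + k) * (1 / (1 - q) ^ (r + 2))) := by
  obtain ⟨j, rfl⟩ : ∃ j, i = j + 1 := ⟨i - 1, by omega⟩
  have hD : 1 / (1 - q) ^ (r + 1) = (1 - q) * (1 / (1 - q) ^ (r + 2)) := by
    field_simp
    ring
  rw [hD]
  generalize 1 / (1 - q) ^ (r + 2) = D
  generalize hx : ((j + 1 : ℕ) : ℂ) = x
  have hj : ∀ n, j + 1 + n - 1 = j + n := by omega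
  -- `a n` is the contribution of `-q` in `(1 - q) * D`. By Pascal's rule the rest of the `n`-th
  -- term carries `-r.choose (n - 1)`, and vanishes at `n = 0`; shifting its index by one aligns it
  -- with `a`.
  set a : ℕ → ℂ := fun n => q ^ (j + 1 + n) * D * (-1) ^ n * r.choose n
    * (falling (r + 1 - n) x * falling n (x + n - 2 - r)) with ha
  have h1 : ∑ n ∈ range (r + 1), a (n + 1) + a 0 = ∑ n ∈ range (r + 1), a n := by
    have h2 := Finset.sum_range_succ' a (r + 1)
    have h3 : a (r + 1) = 0 := by simp [ha]
    rw [Finset.sum_range_succ, h3, add_zero] at h2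
    exact h2.symm
  have h4 : ∑ n ∈ range (r + 1), q ^ (j + 1 + (n + 1) - 1)
        * ((r.choose (n + 1) : ℂ) * ((1 - q) * D) - ((r + 1).choose (n + 1) : ℂ) * D)
        * (-(-1) ^ (n + 1) * (falling (r + 1 - (n + 1)) x
            * falling (n + 1) (x + (n + 1 : ℕ) - 2 - r)))
      = ∑ n ∈ range (r + 1), a (n + 1) - ∑ n ∈ range (r + 1), q ^ (j + 1 + n) * D * (-1) ^ n
        * r.choose n * (falling (r - n) x * falling (n + 1) (x + (n + 1 : ℕ) - 2 - r)) := by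
    rw [← Finset.sum_sub_distrib]
    refine Finset.sum_congr rfl fun n _ => ?_
    rw [ha, hj, Nat.choose_succ_succ', Nat.add_sub_add_right]
    push_cast
    ring
  have h5 : q ^ (j + 1 + 0 - 1)
        * ((r.choose 0 : ℂ) * ((1 - q) * D) - ((r + 1).choose 0 : ℂ) * D)
        * (-(-1) ^ 0 * (falling (r + 1 - 0) x * falling 0 (x + (0 : ℕ) - 2 - r))) = a 0 := by
    rw [ha, hj]
    simp
    ring
  rw [Finset.sum_range_succ', h4, h5, sub_add_eq_add_sub, h1, ← Finset.sum_sub_distrib]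
  refine Finset.sum_congr rfl fun n hn => ?_
  rw [mem_range] at hn
  -- The two products share all falling factors but one, and the remaining factors `x - r + n` and
  -- `x - r + n - 1` differ by `1`.
  have hy : x + (n + 1 : ℕ) - 2 - r - 1 = x - r - 2 + n := by push_cast; ring
  have hy' : x + n - 2 - r = x - r - 2 + n := by ring
  simp only [ha]
  rw [falling_succ_left, hy, hy', show r + 1 - n = r - n + 1 by omega, falling_succ,
    Nat.cast_sub (by omega), numCoeff]
  push_cast
  ring

/-- The binomial sums are `(1 - q) ^ r` and `(1 - q) ^ (r + 1)`, so both parts reduce to `q ^ (i -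
1) / (1 - q)`. -/
theorem sum_neg_one_pow_eq_zero {i : ℕ} (hi : i ≠ 0) (r : ℕ) {q : ℂ} (hq : 1 - q ≠ 0) :
    ∑ n ∈ range (r + 2), q ^ (i + n - 1)
        * ((r.choose n : ℂ) * (1 / (1 - q) ^ (r + 1))
            - ((r + 1).choose n : ℂ) * (1 / (1 - q) ^ (r + 2))) * (-1) ^ n = 0 := by
  obtain ⟨j, rfl⟩ : ∃ j, i = j + 1 := ⟨i - 1, by omega⟩
  have hj : ∀ n, j + 1 + n - 1 = j + n := by omega
  trans q ^ j * ((∑ n ∈ range (r + 1 + 1), (r.choose n : ℂ) * (-1) ^ n * q ^ n)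
      * (1 / (1 - q) ^ (r + 1))
    - (∑ n ∈ range (r + 1 + 1), ((r + 1).choose n : ℂ) * (-1) ^ n * q ^ n)
      * (1 / (1 - q) ^ (r + 2)))
  · rw [Finset.sum_mul, Finset.sum_mul, ← Finset.sum_sub_distrib, Finset.mul_sum]
    refine Finset.sum_congr rfl fun n _ => ?_
    rw [hj]
    ring
  · rw [sum_choose_mul_neg_pow r _ (by omega), sum_choose_mul_neg_pow (r + 1) _ le_rfl]
    field_simp
    ring

/-! ### `Sum4` and `Sum8` as the two halves of a Leibniz expansion. -/

theorem Sum4_eq (s : ℕ) {i : ℕ} (hi : i ≠ 0) {q : ℂ} (hq : q ∈ Metric.ball (0 : ℂ) 1) :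
    Sum4 s q i = ∑ r ∈ range (s + 1), (s.choose r : ℂ)
      * (q ^ r * (i * r.factorial / (1 - q) ^ (r + 1) - (r + 1).factorial / (1 - q) ^ (r + 2))
        * geomDeriv (s - r) i (q ^ i)) := by
  refine Finset.sum_congr rfl fun r hr => ?_
  have hrs : r ≤ s := by simpa [Nat.lt_succ_iff] using hr
  have h := sum_C4 hrs (i := i) (one_sub_ne_zero (pow_mem_ball hq hi))
  trans (q ^ r * (i / (1 - q) ^ (r + 1) - (r + 1) / (1 - q) ^ (r + 2)))
      * ((s.choose r : ℂ) * (r.factorial : ℂ) * geomDeriv (s - r) i (q ^ i))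
  · rw [← h, Finset.mul_sum]
    refine Finset.sum_congr rfl fun p _ => ?_
    rw [Finset.mul_sum]
    refine Finset.sum_congr rfl fun m _ => ?_
    rw [← pow_mul, mul_comm i, pow_add]
    ring
  · rw [Nat.factorial_succ]
    push_cast
    ring

theorem Sum8_eq (s : ℕ) {i : ℕ} (hi : i ≠ 0) {q : ℂ} (hq : q ∈ Metric.ball (0 : ℂ) 1) :
    Sum8 s q i = ∑ r ∈ range (s + 1), (s.choose r : ℂ)
      * ((∑ k ∈ range (r + 1), numCoeff i r k * (q ^ (i + k) * (1 / (1 - q) ^ (r + 2))))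
        * geomDeriv (s - r) i (q ^ i)) := by
  refine Finset.sum_congr rfl fun r hr => ?_
  have hrs : r ≤ s := by simpa [Nat.lt_succ_iff] using hr
  have hq' := one_sub_ne_zero hq
  rw [← sum_falling_eq hi r hq', Finset.sum_mul, Finset.mul_sum]
  set b : ℕ → ℂ := fun n => q ^ (i + n - 1) * ((r.choose n : ℂ) * (1 / (1 - q) ^ (r + 1))
            - ((r + 1).choose n : ℂ) * (1 / (1 - q) ^ (r + 2))) with hb
  -- Extending `w` to `s + 1` makes `sum_C8` applicable; the added terms cancel in the sum over `n`.
  trans ∑ n ∈ range (r + 2), b n * ∑ p ∈ range (s + 1), ∑ w ∈ range (s + 2),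
        (q ^ i) ^ (p + 1) / (1 - q ^ i) ^ (s - r + 1) * i ^ w * (C8 s r p n w : ℂ)
  · simp only [Finset.mul_sum]
    rw [Finset.sum_comm (s := range (r + 2))]
    refine Finset.sum_congr rfl fun p _ => ?_
    simp only [Finset.sum_range_succ _ (s + 1)]
    rw [Finset.sum_add_distrib]
    have hz : ∑ n ∈ range (r + 2), b n * ((q ^ i) ^ (p + 1) / (1 - q ^ i) ^ (s - r + 1)
        * i ^ (s + 1) * (C8 s r p n (s + 1) : ℂ)) = 0 := by
      obtain ⟨K, hK⟩ := exists_C8_succ_eq hrs p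
      have h0 := sum_neg_one_pow_eq_zero hi r hq'
      trans (∑ n ∈ range (r + 2), b n * (-1) ^ n)
        * ((q ^ i) ^ (p + 1) / (1 - q ^ i) ^ (s - r + 1) * i ^ (s + 1) * K)
      · rw [Finset.sum_mul]
        refine Finset.sum_congr rfl fun n hn => ?_
        rw [hK n (by simpa [Nat.lt_succ_iff] using hn)]
        push_cast
        ring
      · rw [h0, zero_mul]
    rw [hz, add_zero]
    refine Finset.sum_congr rfl fun n _ => Finset.sum_congr rfl fun w _ => ?_
    have he : (p + 2) * i + n - 1 = i * (p + 1) + (i + n - 1) := by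
      have : (p + 2) * i = i * (p + 1) + i := by ring
      omega
    rw [he, ← pow_mul, pow_add, hb]
    ring
  · refine Finset.sum_congr rfl fun n hn => ?_
    rw [sum_C8 hrs (by simpa [Nat.lt_succ_iff] using hn)
      (one_sub_ne_zero (pow_mem_ball hq hi))]
    ring

theorem qsDs_mul_geom (s : ℕ) {i : ℕ} (hi : i ≠ 0) {q : ℂ} (hq : q ∈ Metric.ball (0 : ℂ) 1) :
    qsDs s (fun x => (((i : ℂ) / (1 - x) - 1 / (1 - x) ^ 2) + x ^ i / (1 - x) ^ 2)
        * (x ^ i / (1 - x ^ i))) q = Sum4 s q i + Sum8 s q i := by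
  rw [qsDs_mul ((differentiableOn_rational i).fun_add (differentiableOn_main i))
    (differentiableOn_geom i hi) s hq, Sum4_eq s hi hq, Sum8_eq s hi hq,
    ← Finset.sum_add_distrib]
  refine Finset.sum_congr rfl fun r _ => ?_
  rw [qsDs_geom _ hi hq, qsDs_add (differentiableOn_rational i) (differentiableOn_main i) r hq,
    qsDs_rational r _ hq, qsDs_main r i hq]
  ring

/-! ### Domination on smaller discs and termwise differentiation. -/

/-- A family of holomorphic functions on the unit disc, bounded polynomially in the index on
each smaller disc. -/
structure PolyBounded (g : ℕ+ → ℂ → ℂ) : Prop where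
  differentiableOn : ∀ i, DifferentiableOn ℂ (g i) (Metric.ball 0 1)
  bound : ∀ ρ : ℝ, ρ < 1 → ∃ C : ℝ, 0 ≤ C ∧ ∃ K : ℕ, ∀ (i : ℕ+) (q : ℂ), ‖q‖ ≤ ρ →
    ‖g i q‖ ≤ C * ((i : ℕ) : ℝ) ^ K

namespace PolyBounded

variable {g g' : ℕ+ → ℂ → ℂ}

theorem mul (h : PolyBounded g) (h' : PolyBounded g') :
    PolyBounded fun i q => g i q * g' i q := by
  refine ⟨fun i => (h.1 i).mul (h'.1 i), fun ρ hρ => ?_⟩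
  obtain ⟨C, hC, K, hK⟩ := h.2 ρ hρ
  obtain ⟨C', hC', K', hK'⟩ := h'.2 ρ hρ
  refine ⟨C * C', by positivity, K + K', fun i q hq => ?_⟩
  calc ‖g i q * g' i q‖ = ‖g i q‖ * ‖g' i q‖ := norm_mul _ _
    _ ≤ (C * ((i : ℕ) : ℝ) ^ K) * (C' * ((i : ℕ) : ℝ) ^ K') :=
        mul_le_mul (hK i q hq) (hK' i q hq) (norm_nonneg _) (by positivity)
    _ = _ := by ring

theorem sub (h : PolyBounded g) (h' : PolyBounded g') :
    PolyBounded fun i q => g i q - g' i q := by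
  refine ⟨fun i => (h.1 i).sub (h'.1 i), fun ρ hρ => ?_⟩
  obtain ⟨C, hC, K, hK⟩ := h.2 ρ hρ
  obtain ⟨C', hC', K', hK'⟩ := h'.2 ρ hρ
  refine ⟨C + C', by positivity, K + K', fun i q hq => ?_⟩
  have hi : (1 : ℝ) ≤ ((i : ℕ) : ℝ) := by exact_mod_cast i.pos
  calc ‖g i q - g' i q‖ ≤ ‖g i q‖ + ‖g' i q‖ := norm_sub_le _ _
    _ ≤ C * ((i : ℕ) : ℝ) ^ K + C' * ((i : ℕ) : ℝ) ^ K' :=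
        add_le_add (hK i q hq) (hK' i q hq)
    _ ≤ C * ((i : ℕ) : ℝ) ^ (K + K') + C' * ((i : ℕ) : ℝ) ^ (K + K') := by
        gcongr <;> first | exact hi | omega
    _ = _ := by ring

theorem coeff {c : ℕ+ → ℂ} {K : ℕ} (hc : ∀ i, ‖c i‖ ≤ ((i : ℕ) : ℝ) ^ K) :
    PolyBounded fun i _ => c i :=
  ⟨fun _ => differentiableOn_const _, fun _ _ => ⟨1, zero_le_one, K, fun i _ _ => by
    simpa using hc i⟩⟩

theorem const (c : ℂ) : PolyBounded fun _ _ => c :=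
  ⟨fun _ => differentiableOn_const _, fun _ _ => ⟨‖c‖, norm_nonneg _, 0, fun i _ _ => by simp⟩⟩

theorem natCast_pow (m : ℕ) : PolyBounded fun i _ => ((i : ℕ) : ℂ) ^ m :=
  coeff (K := m) fun i => by simp

theorem ipow (β : ℝ) : PolyBounded fun i _ => ipow i β := by
  refine coeff (K := ⌈β⌉₊) fun i => ?_
  have hi : (1 : ℝ) ≤ ((i : ℕ) : ℝ) := by exact_mod_cast i.pos
  rw [LambertDeriv.ipow, Complex.norm_real, Real.norm_of_nonneg (by positivity),
    ← Real.rpow_natCast]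
  exact Real.rpow_le_rpow_of_exponent_le hi (Nat.le_ceil β)

theorem pow (e : ℕ+ → ℕ) : PolyBounded fun i q => q ^ e i := by
  refine ⟨fun i => by fun_prop, fun ρ hρ => ⟨1, zero_le_one, 0, fun i q hq => ?_⟩⟩
  rw [norm_pow]
  simpa using pow_le_one₀ (norm_nonneg q) (hq.trans hρ.le)

theorem one_div_one_sub_pow {e : ℕ+ → ℕ} (he : ∀ i, e i ≠ 0) (k : ℕ) :
    PolyBounded fun i q => 1 / (1 - q ^ e i) ^ k := by
  refine ⟨fun i => ?_, fun ρ hρ => ⟨1 / (1 - ρ) ^ k, ?_, 0, fun i q hq => ?_⟩⟩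
  · exact DifferentiableOn.div (by fun_prop) (by fun_prop) fun q hq =>
      pow_ne_zero _ (one_sub_ne_zero (pow_mem_ball hq (he i)))
  · have : 0 < 1 - ρ := by linarith
    positivity
  · have h0 : 0 < 1 - ρ := by linarith
    -- As `e i ≥ 1`, `‖q ^ e i‖ ≤ ρ` uniformly in `i`.
    have h1 : 1 - ρ ≤ ‖1 - q ^ e i‖ := by
      have h2 : ‖q ^ e i‖ ≤ ρ := by
        rw [norm_pow]
        exact (pow_le_of_le_one (norm_nonneg _) (hq.trans hρ.le) (he i)).trans hq
      have h3 := norm_sub_norm_le (1 : ℂ) (q ^ e i)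
      rw [norm_one] at h3
      linarith
    rw [norm_div, norm_one, norm_pow, pow_zero, mul_one]
    gcongr

end PolyBounded

/-- A family of holomorphic functions on the unit disc, dominated by a convergent series on each
smaller disc. -/
structure SummablyBounded (f : ℕ+ → ℂ → ℂ) : Prop where
  differentiableOn : ∀ i, DifferentiableOn ℂ (f i) (Metric.ball 0 1)
  bound : ∀ ρ : ℝ, 0 ≤ ρ → ρ < 1 → ∃ u : ℕ+ → ℝ, Summable u ∧
    ∀ (i : ℕ+) (q : ℂ), ‖q‖ ≤ ρ → ‖f i q‖ ≤ u i

namespace SummablyBounded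

variable {f g : ℕ+ → ℂ → ℂ}

/-- The factor `q ^ e i` supplies geometric decay `ρ ^ i`, which beats any polynomial growth in `i`.
-/
theorem pow_mul (hg : PolyBounded g) {e : ℕ+ → ℕ} (he : ∀ i : ℕ+, (i : ℕ) ≤ e i) :
    SummablyBounded fun i q => q ^ e i * g i q := by
  refine ⟨fun i => DifferentiableOn.mul (by fun_prop) (hg.1 i), fun ρ hρ0 hρ => ?_⟩
  obtain ⟨C, hC, K, hK⟩ := hg.2 ρ hρ
  have hu : Summable fun n : ℕ => (n : ℝ) ^ K * ρ ^ n :=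
    summable_pow_mul_geometric_of_norm_lt_one K (by rwa [Real.norm_of_nonneg hρ0])
  refine ⟨fun i : ℕ+ => C * (((i : ℕ) : ℝ) ^ K * ρ ^ (i : ℕ)),
    (hu.comp_injective PNat.coe_injective).mul_left C, fun i q hq => ?_⟩
  have h1 : ‖q ^ e i‖ ≤ ρ ^ (i : ℕ) := by
    rw [norm_pow]
    exact (pow_le_pow_of_le_one (norm_nonneg _) (hq.trans hρ.le) (he i)).trans
      (pow_le_pow_left₀ (norm_nonneg _) hq _)
  calc ‖q ^ e i * g i q‖ = ‖q ^ e i‖ * ‖g i q‖ := norm_mul _ _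
    _ ≤ ρ ^ (i : ℕ) * (C * ((i : ℕ) : ℝ) ^ K) :=
        mul_le_mul h1 (hK i q hq) (norm_nonneg _) (by positivity)
    _ = _ := by ring

theorem sum {ι : Type*} {t : Finset ι} {f : ι → ℕ+ → ℂ → ℂ}
    (h : ∀ j ∈ t, SummablyBounded (f j)) : SummablyBounded fun i q => ∑ j ∈ t, f j i q := by
  refine ⟨fun i => DifferentiableOn.fun_sum fun j hj => (h j hj).1 i, fun ρ hρ0 hρ => ?_⟩
  choose! u hu hle using fun j hj => (h j hj).2 ρ hρ0 hρ
  exact ⟨fun i => ∑ j ∈ t, u j i, summable_sum hu, fun i q hq =>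
    norm_sum_le_of_le t fun j hj => hle j hj i q hq⟩

theorem summable (hf : SummablyBounded f) {q : ℂ} (hq : ‖q‖ < 1) : Summable fun i => f i q := by
  obtain ⟨u, hu, hle⟩ := hf.bound _ (norm_nonneg q) hq
  exact Summable.of_norm_bounded hu fun i => hle i q le_rfl

theorem tendstoLocallyUniformlyOn (hf : SummablyBounded f) :
    TendstoLocallyUniformlyOn (fun (t : Finset ℕ+) q => ∑ i ∈ t, f i q)
      (fun q => ∑' i, f i q) Filter.atTop (Metric.ball 0 1) := by
  intro v hv x hx
  obtain ⟨ρ, hxρ, hρ⟩ := exists_between (mem_ball_zero_iff.1 hx)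
  obtain ⟨u, hu, hle⟩ := hf.bound _ ((norm_nonneg x).trans hxρ.le) hρ
  refine ⟨Metric.ball 0 ρ, mem_nhdsWithin_of_mem_nhds
    (Metric.isOpen_ball.mem_nhds (mem_ball_zero_iff.2 hxρ)), ?_⟩
  exact tendstoUniformlyOn_tsum hu (s := Metric.ball 0 ρ)
    (fun i q hq => hle i q (mem_ball_zero_iff.1 hq).le) v hv

theorem differentiableOn_sum (hf : SummablyBounded f) (t : Finset ℕ+) :
    DifferentiableOn ℂ (fun q => ∑ i ∈ t, f i q) (Metric.ball 0 1) :=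
  DifferentiableOn.fun_sum fun i _ => hf.1 i

theorem differentiableOn_tsum (hf : SummablyBounded f) :
    DifferentiableOn ℂ (fun q => ∑' i, f i q) (Metric.ball 0 1) :=
  hf.tendstoLocallyUniformlyOn.differentiableOn
    (Filter.Eventually.of_forall hf.differentiableOn_sum) Metric.isOpen_ball

end SummablyBounded

theorem _root_.TendstoLocallyUniformlyOn.iteratedDeriv {ι : Type*} {φ : Filter ι} {U : Set ℂ}
    {F : ι → ℂ → ℂ} {f : ℂ → ℂ} (hf : TendstoLocallyUniformlyOn F f φ U)
    (hF : ∀ n, DifferentiableOn ℂ (F n) U) (hU : IsOpen U) (k : ℕ) :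
    TendstoLocallyUniformlyOn (fun n => iteratedDeriv k (F n)) (iteratedDeriv k f) φ U := by
  induction k with
  | zero => simpa [iteratedDeriv_zero] using hf
  | succ k ih =>
    simp only [iteratedDeriv_succ]
    refine ih.deriv (Filter.Eventually.of_forall fun n => ?_) hU
    intro z hz
    rw [iteratedDeriv_eq_iterate]
    exact (((hF n).analyticAt (hU.mem_nhds hz)).iterated_deriv
      k).differentiableAt.differentiableWithinAt

theorem SummablyBounded.hasSum_qsDs {f : ℕ+ → ℂ → ℂ} (hf : SummablyBounded f) (s : ℕ) {q : ℂ}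
    (hq : q ∈ Metric.ball (0 : ℂ) 1) :
    HasSum (fun i => qsDs s (f i) q) (qsDs s (fun q => ∑' i, f i q) q) := by
  refine HasSum.mul_left _ ?_
  have h := (hf.tendstoLocallyUniformlyOn.iteratedDeriv hf.differentiableOn_sum
    Metric.isOpen_ball s).tendsto_at hq
  rw [HasSum]
  convert! h using 2 with t
  exact (iteratedDeriv_fun_sum fun i _ => (analyticAt_of_ball (hf.1 i) hq).contDiffAt).symm

theorem summablyBounded_lambertTerm (α : ℝ) : SummablyBounded fun i q => lambertTerm α q i := by
  convert! SummablyBounded.pow_mul (e := fun i => i) ((PolyBounded.ipow α).mul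
    (PolyBounded.one_div_one_sub_pow (e := fun i => i) (fun i => i.ne_zero) 1))
    (fun i => le_rfl) using 3 with i q
  rw [lambertTerm]
  ring

theorem summablyBounded_one_div_mul_lambertTerm (α : ℝ) :
    SummablyBounded fun i q => 1 / (1 - q) * lambertTerm α q i := by
  convert! SummablyBounded.pow_mul (e := fun i => i) (((PolyBounded.ipow α).mul
    (PolyBounded.one_div_one_sub_pow (e := fun i => i) (fun i => i.ne_zero) 1)).mul
    (PolyBounded.one_div_one_sub_pow (e := fun _ => 1) (fun _ => one_ne_zero) 1))
    (fun i => le_rfl) using 3 with i q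
  rw [lambertTerm]
  ring

theorem summablyBounded_mainTerm (α : ℝ) : SummablyBounded fun i q => mainTerm α q i := by
  convert! SummablyBounded.pow_mul (e := fun i => i) ((PolyBounded.ipow (α - 1)).mul
    (PolyBounded.one_div_one_sub_pow (e := fun _ => 1) (fun _ => one_ne_zero) 2))
    (fun i => le_rfl) using 3 with i q
  rw [mainTerm]
  ring

theorem summablyBounded_Sum4 (s : ℕ) (β : ℝ) :
    SummablyBounded fun i q => Sum4 s q i * ipow i β := by
  simp only [Sum4, Finset.sum_mul]
  refine .sum fun r _ => .sum fun p _ => .sum fun m _ => ?_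
  have h := fun k => PolyBounded.one_div_one_sub_pow (e := fun _ => 1) (fun _ => one_ne_zero) k
  convert! SummablyBounded.pow_mul (e := fun i => (p + 1) * i + r)
    ((((PolyBounded.one_div_one_sub_pow (e := fun i => i) (fun i => i.ne_zero) (s - r + 1)).mul
      (((PolyBounded.natCast_pow (m + 1)).mul (h (r + 1))).sub
      (((PolyBounded.const (r + 1)).mul (PolyBounded.natCast_pow m)).mul (h (r + 2))))).mul
      (PolyBounded.const (C4 s r p m))).mul (PolyBounded.ipow β)) (fun i => by nlinarith) using 3
    with i q
  ring

theorem summablyBounded_Sum8 (s : ℕ) (β : ℝ) :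
    SummablyBounded fun i q => Sum8 s q i * ipow i β := by
  simp only [Sum8, Finset.sum_mul]
  refine .sum fun r _ => .sum fun p _ => .sum fun n _ => .sum fun w _ => ?_
  have h := fun k => PolyBounded.one_div_one_sub_pow (e := fun _ => 1) (fun _ => one_ne_zero) k
  have he : ∀ i : ℕ+, (i : ℕ) ≤ (p + 2) * i + n - 1 := by
    intro i
    have h1 := i.pos
    have h2 : (p + 2) * (i : ℕ) = p * i + i + i := by ring
    omega
  convert! SummablyBounded.pow_mul (e := fun i => (p + 2) * i + n - 1)
    (((((PolyBounded.one_div_one_sub_pow (e := fun i => i) (fun i => i.ne_zero) (s - r + 1)).mul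
      (((PolyBounded.const (r.choose n)).mul (h (r + 1))).sub
      ((PolyBounded.const ((r + 1).choose n)).mul (h (r + 2))))).mul
      (PolyBounded.natCast_pow w)).mul
      (PolyBounded.const (C8 s r p n w))).mul (PolyBounded.ipow β)) he using 3
    with i q
  ring

/-! ### Assembly: termwise identity, summation and coefficients. -/

theorem ipow_eq (i : ℕ+) (α : ℝ) : ipow i α = i * ipow i (α - 1) := by
  have hi : (0 : ℝ) < ((i : ℕ) : ℝ) := by exact_mod_cast i.pos
  have h : ((i : ℕ) : ℝ) ^ α = i * ((i : ℕ) : ℝ) ^ (α - 1) := by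
    rw [Real.rpow_sub_one hi.ne', mul_div_cancel₀ _ hi.ne']
  rw [ipow, ipow, h]
  push_cast
  rfl

theorem qsDs_congr {f g : ℂ → ℂ} (h : Set.EqOn f g (Metric.ball 0 1)) (s : ℕ) {q : ℂ}
    (hq : q ∈ Metric.ball (0 : ℂ) 1) : qsDs s f q = qsDs s g q := by
  rw [qsDs, qsDs, (h.eventuallyEq_of_mem (Metric.isOpen_ball.mem_nhds hq)).iteratedDeriv_eq]

theorem qsDs_one_div_mul_lambertTerm (α : ℝ) (s : ℕ) (i : ℕ+) {q : ℂ}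
    (hq : q ∈ Metric.ball (0 : ℂ) 1) :
    qsDs s (fun q => 1 / (1 - q) * lambertTerm α q i) q
      = qsDs s (fun q => mainTerm α q i) q + (Sum4 s q i + Sum8 s q i) * ipow i (α - 1) := by
  have hd := ((differentiableOn_rational (i : ℕ)).fun_add (differentiableOn_main i)).fun_mul
    (differentiableOn_geom i i.ne_zero)
  rw [← qsDs_mul_geom s i.ne_zero hq, qsDs_congr (g := fun x => mainTerm α x i + ipow i (α - 1)
    * ((((i : ℕ) : ℂ) / (1 - x) - 1 / (1 - x) ^ 2 + x ^ (i : ℕ) / (1 - x) ^ 2)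
        * (x ^ (i : ℕ) / (1 - x ^ (i : ℕ))))) _ s hq,
    qsDs_add ((summablyBounded_mainTerm α).1 i) (hd.const_mul _) s hq]
  · congr 1
    rw [qsDs, iteratedDeriv_const_mul_field, qsDs]
    ring
  · intro x hx
    have h1 := one_sub_ne_zero hx
    have h2 := one_sub_ne_zero (pow_mem_ball hx i.ne_zero)
    simp only [lambertTerm, mainTerm, ipow_eq i α]
    field_simp
    ring

/-- Valid for every `q`: in a field a constant factor passes through `∑'` even without summability.
-/
theorem A_eq (α : ℝ) : A α = fun q => ∑' i : ℕ+, 1 / (1 - q) * lambertTerm α q i := by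
  funext q
  rw [A, F, tsum_mul_left]

theorem qsDs_A_eq (α : ℝ) (s : ℕ) {q : ℂ} (hq : q ∈ Metric.ball (0 : ℂ) 1) :
    qsDs s (A α) q = qsDs s (B α) q
      + ∑' i : ℕ+, (Sum4 s q i + Sum8 s q i) * ipow i (α - 1) := by
  have hA := (summablyBounded_one_div_mul_lambertTerm α).hasSum_qsDs s hq
  have hB := (summablyBounded_mainTerm α).hasSum_qsDs s hq
  have h := hA.sub hB
  simp only [qsDs_one_div_mul_lambertTerm α s _ hq, add_sub_cancel_left] at h
  rw [h.tsum_eq, A_eq]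
  exact (add_sub_cancel _ _).symm

theorem analyticAt_qsDs {f : ℂ → ℂ} (hf : DifferentiableOn ℂ f (Metric.ball 0 1)) (s : ℕ) {q : ℂ}
    (hq : q ∈ Metric.ball (0 : ℂ) 1) : AnalyticAt ℂ (qsDs s f) q := by
  have h := (analyticAt_of_ball hf hq).iterated_deriv s
  rw [← iteratedDeriv_eq_iterate] at h
  exact (analyticAt_id.pow s).mul h

theorem coeff_add {f g : ℂ → ℂ} (hf : AnalyticAt ℂ f 0) (hg : AnalyticAt ℂ g 0) (x : ℕ) :
    coeff x (fun q => f q + g q) = coeff x f + coeff x g := by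
  rw [coeff, iteratedDeriv_fun_add hf.contDiffAt hg.contDiffAt, add_div]
  rfl

end LambertDeriv

theorem mainTheorem1 (α : ℝ) (hα : 0 ≤ α) (s : ℕ) (hs : 1 ≤ s) :
    -- all series converge in the open unit disc
    (∀ q : ℂ, ‖q‖ < 1 →
      Summable (LambertDeriv.lambertTerm α q) ∧
      Summable (LambertDeriv.mainTerm α q) ∧
      Summable (fun i : ℕ+ => LambertDeriv.Sum4 s q i * LambertDeriv.ipow i (α - 1)) ∧
      Summable (fun i : ℕ+ => LambertDeriv.Sum8 s q i * LambertDeriv.ipow i (α - 1))) ∧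
    -- and their sums are holomorphic there
    (DifferentiableOn ℂ (LambertDeriv.A α) (Metric.ball 0 1) ∧
      DifferentiableOn ℂ (LambertDeriv.B α) (Metric.ball 0 1) ∧
      DifferentiableOn ℂ (LambertDeriv.T4 s α) (Metric.ball 0 1) ∧
      DifferentiableOn ℂ (LambertDeriv.T8 s α) (Metric.ball 0 1)) ∧
    -- the identity of functions
    (∀ q : ℂ, ‖q‖ < 1 →
      LambertDeriv.qsDs s (LambertDeriv.A α) q =
        LambertDeriv.qsDs s (LambertDeriv.B α) q +
          ∑' i : ℕ+, (LambertDeriv.Sum4 s q i + LambertDeriv.Sum8 s q i)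
            * LambertDeriv.ipow i (α - 1)) ∧
    -- the identity of power series coefficients
    (∀ x : ℕ, 1 ≤ x →
      LambertDeriv.L α s x =
        LambertDeriv.S00 α s x + LambertDeriv.S4 α s x + LambertDeriv.S8 α s x) := by
  open LambertDeriv in
  have h4 := summablyBounded_Sum4 s (α - 1)
  have h8 := summablyBounded_Sum8 s (α - 1)
  have hB : DifferentiableOn ℂ (B α) (Metric.ball 0 1) :=
    (summablyBounded_mainTerm α).differentiableOn_tsum
  have hT4 : DifferentiableOn ℂ (T4 s α) (Metric.ball 0 1) := h4.differentiableOn_tsum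
  have hT8 : DifferentiableOn ℂ (T8 s α) (Metric.ball 0 1) := h8.differentiableOn_tsum
  refine ⟨fun q hq => ⟨(summablyBounded_lambertTerm α).summable hq,
    (summablyBounded_mainTerm α).summable hq, h4.summable hq, h8.summable hq⟩,
    ⟨?_, hB, hT4, hT8⟩, fun q hq => qsDs_A_eq α s (mem_ball_zero_iff.2 hq), fun x _ => ?_⟩
  · rw [A_eq]
    exact (summablyBounded_one_div_mul_lambertTerm α).differentiableOn_tsum
  · have h0 : (0 : ℂ) ∈ Metric.ball (0 : ℂ) 1 := Metric.mem_ball_self one_pos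
    -- Coefficients at `0` depend only on the germ, so equality near `0` is enough.
    have h : qsDs s (A α) =ᶠ[nhds 0] fun q => (qsDs s (B α) q + T4 s α q) + T8 s α q := by
      filter_upwards [Metric.isOpen_ball.mem_nhds h0] with q hq
      have hq' := mem_ball_zero_iff.1 hq
      rw [qsDs_A_eq α s hq, T4, T8, add_assoc, ← (h4.summable hq').tsum_add (h8.summable hq')]
      simp only [add_mul]
    have hqB := analyticAt_qsDs hB s h0
    have hq4 := analyticAt_of_ball hT4 h0
    have hq8 := analyticAt_of_ball hT8 h0
    rw [L, S00, S4, S8, ← coeff_add hqB hq4, ← coeff_add (hqB.fun_add hq4) hq8, coeff, coeff,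
      h.iteratedDeriv_eq]
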